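/- Let $n\ge 1$ and let $p=\mathrm{normal}(\boldsymbol\mu,\boldsymbol\Sigma)$ be a Gaussian distribution on $\mathbb{R}^n$ whose covariance matrix $\boldsymbol\Sigma$ is positive definite but not diagonal. Let $\mathcal{Q}$ be the family of Gaussian distributions $\mathrm{normal}(\boldsymbol\nu,\boldsymbol\Psi)$ on $\mathbb{R}^n$ with $\boldsymbol\Psi$ diagonal and positive definite. For $\alpha\in(0,1)$ and $q\in\mathcal{Q}$, identify $p$ and $q$ with their Lebesgue densities and let $$R_\alpha(p\|q)=\frac{1}{\alpha(\alpha-1)}\int_{\mathbb{R}^n}\left(\frac{p(\mathbf z)^\alpha}{q(\mathbf z)^\alpha}-1\right)q(\mathbf z)\,d\mathbf z .$$ Write $\mathcal{H}(q)=-\int q(\mathbf z)\log q(\mathbf z)\,d\mathbf z$ for the entropy, and call the determinant of the covariance matrix the generalized variance. Then: 1. for every $\alpha\in(0,1)$ there is a unique minimizer $q_\alpha$ of $R_\alpha(p\|q)$ over $q\in\mathcal{Q}$; 2. there is a unique $\alpha\in(0,1)$ such that $\mathcal{H}(q_\alpha)=\mathcal{H}(p)$; 3. for every $q\in\mathcal{Q}$,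 $\mathcal{H}(q)=\mathcal{H}(p)$ if and only if $q$ and $p$ have the same generalized variance; thus the $\alpha$ in part 2 is also the unique $\alpha\in(0,1)$ for which $q_\alpha$ has the same generalized variance as $p$. -/

import Mathlib

open MeasureTheory ProbabilityTheory Set

namespace FactorizedVI

/-- The density of a measure on `ℝⁿ` with respect to Lebesgue measure. -/
noncomputable def density {n : ℕ} (p : Measure (EuclideanSpace ℝ (Fin n)))
    (z : EuclideanSpace ℝ (Fin n)) : ℝ :=
  (p.rnDeriv volume z).toReal

/-- The Rényi divergence (α-divergence) of order `α`,
`R_α(p‖q) = 1 / (α (α - 1)) * ∫ (p(z)^α / q(z)^α - 1) q(z) dz`,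
for `p` and `q` with Lebesgue densities. -/
noncomputable def renyiDiv {n : ℕ} (α : ℝ) (p q : Measure (EuclideanSpace ℝ (Fin n))) : ℝ :=
  1 / (α * (α - 1)) *
    ∫ z, (density p z ^ α / density q z ^ α - 1) * density q z

/-- The differential entropy `-∫ p(z) log p(z) dz`. -/
noncomputable def entropy {n : ℕ} (p : Measure (EuclideanSpace ℝ (Fin n))) : ℝ :=
  -∫ z, density p z * Real.log (density p z)

/-- The covariance matrix of a measure on `ℝⁿ`. -/
noncomputable def covMatrix {n : ℕ} (p : Measure (EuclideanSpace ℝ (Fin n))) :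
    Matrix (Fin n) (Fin n) ℝ :=
  Matrix.of fun i j => cov[fun z => z i, fun z => z j; p]

/-- The generalized variance: the determinant of the covariance matrix. -/
noncomputable def generalizedVariance {n : ℕ} (p : Measure (EuclideanSpace ℝ (Fin n))) : ℝ :=
  (covMatrix p).det

/-- The variational family of nondegenerate Gaussians with diagonal covariance. -/
def factorizedGaussians (n : ℕ) : Set (Measure (EuclideanSpace ℝ (Fin n))) :=
  {q | ∃ (ν : EuclideanSpace ℝ (Fin n)) (Ψ : Matrix (Fin n) (Fin n) ℝ),
    Ψ.PosDef ∧ Ψ.IsDiag ∧ q = multivariateGaussian ν Ψ}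

/-- `q` is a factorized Gaussian that minimizes `R_α(p‖·)` over all factorized Gaussians. -/
def IsRenyiMinimizer {n : ℕ} (α : ℝ) (p q : Measure (EuclideanSpace ℝ (Fin n))) : Prop :=
  q ∈ factorizedGaussians n ∧ IsMinOn (fun q' => renyiDiv α p q') (factorizedGaussians n) q

end FactorizedVI

/-! Write `D` for the diagonal covariance of `q`, with entries `d i`, and `M = α D + (1 - α) S`.
Completing the square in `p ^ α * q ^ (1 - α)` gives the divergence in closed form: a negative
factor times `exp` of an expression decreasing in `log det M - α ∑ log (d i)` plus a penalty `κ ≥ 0`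
that vanishes exactly when the means agree. So the minimizer has the mean of `p`, and its variances
minimize `objective`, whose stationarity equations are `d i * M⁻¹ i i = 1`.

All estimates rest on the formula that `M⁻¹ i i` is the maximum over `x` of `2 x i - x ⬝ᵥ M *ᵥ x`. A
maximum of functions affine in `M` and decreasing in the Loewner order is convex and antitone.
Antitonicity with a scaling argument shows that a subsolution lies below a solution
(`subsolution_le`), hence solutions are unique. Coordinatewise minimization lands in the box of
vectors between `(S⁻¹ i i)⁻¹` and `S i i`, so compactness gives a minimizer. Convexity shows that a
solution at order `α` is a subsolution at every larger order, strictly so in some coordinate as `S`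
is not diagonal; thus `∏ d i` strictly increases with `α` (`solution_strictMono`).

The solutions at the endpoints `0` and `1` are `(S⁻¹ i i)⁻¹` and `S i i`. Strict Hadamard
inequalities for `S⁻¹` and `S` put `det S` strictly between their products, and a connectedness
argument yields an order with `∏ d i = det S`. Gaussian entropy is a constant plus half the
log-determinant, so matching entropy, matching determinant and matching generalized variance are the
same condition. -/

namespace FactorizedVI

open Matrix

/-! ### Interpolation between a diagonal matrix and `S`. -/

section Interpolation

variable {ι : Type*} [DecidableEq ι]

/-- The matrix interpolating between a diagonal matrix and `S`. -/
def interp (S : Matrix ι ι ℝ) (α : ℝ) (d : ι → ℝ) : Matrix ι ι ℝ :=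
  α • diagonal d + (1 - α) • S

theorem posDef_interp {S : Matrix ι ι ℝ} (hS : S.PosDef) {α : ℝ} (hα : α ∈ Icc (0 : ℝ) 1)
    {d : ι → ℝ} (hd : ∀ i, 0 < d i) : (interp S α d).PosDef := by
  have hD : (diagonal d).PosDef := PosDef.diagonal hd
  rcases hα.1.eq_or_lt with h0 | h0
  · simpa [interp, ← h0] using hS
  · exact (hD.smul h0).add_posSemidef (hS.posSemidef.smul (sub_nonneg.2 hα.2))

/-- For fixed `a` these matrices run along the line from `S` to `diagonal a`. When `α < β < 1` the
coefficients are positive, so convexity of inversion can compare the two orders. -/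
theorem interp_reparam (S : Matrix ι ι ℝ) {α : ℝ} (hα : α < 1) (β : ℝ) (a : ι → ℝ) :
    interp S β a = (1 - (1 - β) / (1 - α)) • diagonal a + ((1 - β) / (1 - α)) • interp S α a := by
  have h : 1 - α ≠ 0 := (sub_pos.2 hα).ne'
  have h1 : (1 - (1 - β) / (1 - α)) + (1 - β) / (1 - α) * α = β := by field_simp; ring
  have h2 : (1 - β) / (1 - α) * (1 - α) = 1 - β := by field_simp
  rw [interp, interp, smul_add, smul_smul, smul_smul, ← add_assoc, ← add_smul, h1, h2]

theorem isDiag_of_interp_eq {S : Matrix ι ι ℝ} {α : ℝ} (hα : α < 1) {a : ι → ℝ}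
    (h : diagonal a = interp S α a) : S.IsDiag := by
  intro i j hij
  have := congrFun (congrFun h i) j
  simp only [interp, Matrix.add_apply, Matrix.smul_apply, diagonal_apply_ne _ hij, smul_eq_mul,
    mul_zero, zero_add] at this
  rcases mul_eq_zero.1 this.symm with h | h
  · linarith
  · exact h

/-- Changing one variance changes one row, by a multiple of a basis vector; this makes the
determinant affine in each variance separately. -/
theorem interp_update (S : Matrix ι ι ℝ) (α : ℝ) (d : ι → ℝ) (i : ι) (x : ℝ) :
    interp S α (Function.update d i x) = (interp S α d).updateRow i
      (interp S α d i + (α * (x - d i)) • Pi.single i 1) := by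
  ext j k
  by_cases hj : j = i
  · subst hj
    by_cases hk : j = k
    · subst hk
      simp [interp]
      ring
    · simp [interp, hk, Ne.symm hk]
  · rw [updateRow_ne hj]
    by_cases hk : j = k
    · subst hk
      simp [interp, hj]
    · simp [interp, hk]

theorem update_pos {d : ι → ℝ} (hd : ∀ i, 0 < d i) (i : ι) {x : ℝ} (hx : 0 < x) (j : ι) :
    0 < Function.update d i x j := by
  by_cases h : j = i
  · subst h; simpa
  · simpa [h] using hd j

theorem continuous_interp (S : Matrix ι ι ℝ) :
    Continuous fun p : ℝ × (ι → ℝ) => interp S p.1 p.2 := by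
  unfold interp
  exact (continuous_fst.smul continuous_snd.matrix_diagonal).add
    ((continuous_const.sub continuous_fst).smul continuous_const)

end Interpolation

/-! ### Diagonal entries of the inverse: variational formula, monotonicity, convexity. -/

section Stationarity

variable {ι : Type*} [Fintype ι] [DecidableEq ι]

/-- Completing the square: the defect in the variational formula for a diagonal entry of the
inverse of a positive definite matrix. -/
theorem inv_diag_sub_quadratic {M : Matrix ι ι ℝ} (hM : M.PosDef) (i : ι) (x : ι → ℝ) :
    M⁻¹ i i - (2 * x i - x ⬝ᵥ M *ᵥ x) =
      (x - M⁻¹ *ᵥ Pi.single i 1) ⬝ᵥ M *ᵥ (x - M⁻¹ *ᵥ Pi.single i 1) := by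
  have hdet : IsUnit M.det := hM.det_pos.ne'.isUnit
  have hMy : M *ᵥ (M⁻¹ *ᵥ Pi.single i 1) = Pi.single i 1 := by
    rw [mulVec_mulVec, mul_nonsing_inv _ hdet, one_mulVec]
  have hsymm : Mᵀ = M := by simpa using hM.isHermitian.eq
  have hcomm : (M⁻¹ *ᵥ Pi.single i 1) ⬝ᵥ M *ᵥ x = x i := by
    rw [dotProduct_mulVec, ← mulVec_transpose, hsymm, hMy, single_one_dotProduct]
  rw [mulVec_sub, hMy, sub_dotProduct, dotProduct_sub, dotProduct_sub, hcomm]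
  simp
  ring

/-- The defect is a positive semidefinite form, vanishing at `M⁻¹ *ᵥ Pi.single i 1`. Evaluating the
bound for one matrix at the maximizer of another gives the order and convexity properties below. -/
theorem quadratic_le_inv_diag {M : Matrix ι ι ℝ} (hM : M.PosDef) (i : ι) (x : ι → ℝ) :
    2 * x i - x ⬝ᵥ M *ᵥ x ≤ M⁻¹ i i := by
  have h := inv_diag_sub_quadratic hM i x
  have := hM.posSemidef.dotProduct_mulVec_nonneg (x - M⁻¹ *ᵥ Pi.single i 1)
  simp only [star_trivial] at this
  linarith

theorem quadratic_lt_inv_diag {M : Matrix ι ι ℝ} (hM : M.PosDef) {i : ι} {x : ι → ℝ}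
    (hx : x ≠ M⁻¹ *ᵥ Pi.single i 1) : 2 * x i - x ⬝ᵥ M *ᵥ x < M⁻¹ i i := by
  have h := inv_diag_sub_quadratic hM i x
  have := hM.dotProduct_mulVec_pos (sub_ne_zero.2 hx)
  simp only [star_trivial] at this
  linarith

theorem quadratic_eq_inv_diag {M : Matrix ι ι ℝ} (hM : M.PosDef) (i : ι) :
    2 * (M⁻¹ *ᵥ Pi.single i 1) i - (M⁻¹ *ᵥ Pi.single i 1) ⬝ᵥ M *ᵥ (M⁻¹ *ᵥ Pi.single i 1) =
      M⁻¹ i i := by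
  have h := inv_diag_sub_quadratic hM i (M⁻¹ *ᵥ Pi.single i 1)
  simp only [sub_self, zero_dotProduct] at h
  linarith

/-- Inversion reverses the Loewner order, on diagonal entries. -/
theorem inv_diag_antitone {M N : Matrix ι ι ℝ} (hM : M.PosDef) (hN : N.PosDef)
    (h : (N - M).PosSemidef) (i : ι) : N⁻¹ i i ≤ M⁻¹ i i := by
  have h1 := quadratic_eq_inv_diag hN i
  have h2 := quadratic_le_inv_diag hM i (N⁻¹ *ᵥ Pi.single i 1)
  have h3 := h.dotProduct_mulVec_nonneg (N⁻¹ *ᵥ Pi.single i 1)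
  simp only [star_trivial, sub_mulVec, dotProduct_sub] at h3
  linarith

theorem inv_mulVec_single_ne_zero {M : Matrix ι ι ℝ} (hM : M.PosDef) (i : ι) :
    M⁻¹ *ᵥ Pi.single i 1 ≠ 0 := by
  intro h0
  have h1 : (M⁻¹ *ᵥ Pi.single i 1) i = 0 := by rw [h0]; rfl
  have h2 := hM.inv.diag_pos (i := i)
  simp at h1
  linarith

theorem inv_diag_strictAnti {M N : Matrix ι ι ℝ} (hM : M.PosDef) (hN : N.PosDef)
    (h : (N - M).PosDef) (i : ι) : N⁻¹ i i < M⁻¹ i i := by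
  have h1 := quadratic_eq_inv_diag hN i
  have h2 := quadratic_le_inv_diag hM i (N⁻¹ *ᵥ Pi.single i 1)
  have h3 := h.dotProduct_mulVec_pos (inv_mulVec_single_ne_zero hN i)
  simp only [star_trivial, sub_mulVec, dotProduct_sub] at h3
  linarith

theorem one_le_diag_mul_inv_diag {M : Matrix ι ι ℝ} (hM : M.PosDef) (i : ι) :
    1 ≤ M i i * M⁻¹ i i := by
  have hp := hM.diag_pos (i := i)
  have h := quadratic_le_inv_diag hM i (Pi.single i (M i i)⁻¹)
  simp only [Pi.single_eq_same, single_dotProduct, mulVec_single] at h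
  simp at h
  have : 2 * (M i i)⁻¹ - (M i i)⁻¹ * (M i i * (M i i)⁻¹) = (M i i)⁻¹ := by
    field_simp; norm_num
  have h' : (M i i)⁻¹ ≤ M⁻¹ i i := by nlinarith
  calc (1 : ℝ) = M i i * (M i i)⁻¹ := by field_simp
    _ ≤ _ := by gcongr

/-- Convexity of inversion, on diagonal entries. -/
theorem inv_diag_convex {A B : Matrix ι ι ℝ} (hA : A.PosDef) (hB : B.PosDef) {r : ℝ}
    (hr : r ∈ Icc (0 : ℝ) 1) (hM : ((1 - r) • A + r • B).PosDef) (i : ι) :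
    ((1 - r) • A + r • B)⁻¹ i i ≤ (1 - r) * A⁻¹ i i + r * B⁻¹ i i := by
  set x := ((1 - r) • A + r • B)⁻¹ *ᵥ Pi.single i 1 with hx
  have h := quadratic_eq_inv_diag hM i
  rw [← hx] at h
  simp only [add_mulVec, smul_mulVec, dotProduct_add, dotProduct_smul, smul_eq_mul] at h
  have h1 := mul_le_mul_of_nonneg_left (quadratic_le_inv_diag hA i x) (sub_nonneg.2 hr.2)
  have h2 := mul_le_mul_of_nonneg_left (quadratic_le_inv_diag hB i x) hr.1
  linarith

theorem inv_diag_strictConvex {A B : Matrix ι ι ℝ} (hA : A.PosDef) (hB : B.PosDef) {r : ℝ}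
    (hr : r ∈ Ioo (0 : ℝ) 1) (hM : ((1 - r) • A + r • B).PosDef) {i : ι}
    (hi : A⁻¹ *ᵥ Pi.single i 1 ≠ B⁻¹ *ᵥ Pi.single i 1) :
    ((1 - r) • A + r • B)⁻¹ i i < (1 - r) * A⁻¹ i i + r * B⁻¹ i i := by
  set x := ((1 - r) • A + r • B)⁻¹ *ᵥ Pi.single i 1 with hx
  have h := quadratic_eq_inv_diag hM i
  rw [← hx] at h
  simp only [add_mulVec, smul_mulVec, dotProduct_add, dotProduct_smul, smul_eq_mul] at h
  have h1 := mul_le_mul_of_nonneg_left (quadratic_le_inv_diag hA i x) (sub_nonneg.2 hr.2.le)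
  by_cases hxB : x = B⁻¹ *ᵥ Pi.single i 1
  · have h1 := mul_lt_mul_of_pos_left (quadratic_lt_inv_diag hA (i := i) (x := x)
      (fun e => hi (e.symm.trans hxB))) (sub_pos.2 hr.2)
    have h2 := mul_le_mul_of_nonneg_left (quadratic_le_inv_diag hB i x) hr.1.le
    linarith
  · have h2 := mul_lt_mul_of_pos_left (quadratic_lt_inv_diag hB hxB) hr.1
    linarith

/-! ### Comparison, uniqueness and monotonicity of solutions. -/

/-- A subsolution of the stationarity equations lies below a solution. -/
theorem subsolution_le {S : Matrix ι ι ℝ} (hS : S.PosDef) {α : ℝ} (hα : α ∈ Ico (0 : ℝ) 1)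
    {a b : ι → ℝ} (ha : ∀ i, 0 < a i) (hb : ∀ i, 0 < b i)
    (hsub : ∀ i, a i * (interp S α a)⁻¹ i i ≤ 1)
    (hsol : ∀ i, b i * (interp S α b)⁻¹ i i = 1) : ∀ i, a i ≤ b i := by
  have hα' : α ∈ Icc (0 : ℝ) 1 := ⟨hα.1, hα.2.le⟩
  by_contra! hcon
  obtain ⟨k, hk⟩ := hcon
  have : Nonempty ι := ⟨k⟩
  obtain ⟨i, hi⟩ := Finite.exists_max fun j => a j / b j
  -- Since `c` is the largest ratio, `c • b` dominates `a` and touches it at `i`. If `c > 1`, the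
  -- chain `1 = a i * (c • interp S α b)⁻¹ i i < a i * (interp S α (c • b))⁻¹ i i ≤ a i * (interp S
  -- α a)⁻¹ i i ≤ 1` is contradictory.
  set c := a i / b i with hc
  have hc1 : 1 < c := lt_of_lt_of_le ((one_lt_div (hb k)).2 hk) (hi k)
  have hc0 : 0 < c := by linarith
  have hle : ∀ j, a j ≤ c * b j := fun j => (div_le_iff₀ (hb j)).1 (hi j)
  have hai : a i = c * b i := by rw [hc, div_mul_cancel₀ _ (hb i).ne']
  have hcb : ∀ j, 0 < (c • b) j := fun j => mul_pos hc0 (hb j)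
  have h1 : (interp S α (c • b))⁻¹ i i ≤ (interp S α a)⁻¹ i i := by
    refine inv_diag_antitone (posDef_interp hS hα' ha) (posDef_interp hS hα' hcb) ?_ i
    have : interp S α (c • b) - interp S α a = α • diagonal (c • b - a) := by
      have hd : diagonal (c • b - a) = diagonal (c • b) - diagonal a :=
        (diagonal_sub (c • b) a).symm
      rw [hd, interp, interp, smul_sub]; abel
    rw [this]
    refine (PosSemidef.diagonal fun j => ?_).smul hα.1
    simpa using hle j
  have h2 : (c • interp S α b)⁻¹ i i < (interp S α (c • b))⁻¹ i i := by
    refine inv_diag_strictAnti (posDef_interp hS hα' hcb)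
      ((posDef_interp hS hα' hb).smul hc0) ?_ i
    have : c • interp S α b - interp S α (c • b) = ((c - 1) * (1 - α)) • S := by
      rw [interp, interp, diagonal_smul, smul_add, smul_smul, smul_smul, smul_smul, mul_comm c α,
        add_sub_add_left_eq_sub, ← sub_smul]
      congr 1; ring
    rw [this]
    exact hS.smul (mul_pos (sub_pos.2 hc1) (sub_pos.2 hα.2))
  have hinv : (c • interp S α b)⁻¹ = c⁻¹ • (interp S α b)⁻¹ := by
    have := invertibleOfNonzero hc0.ne'
    rw [inv_smul _ _ (posDef_interp hS hα' hb).det_pos.ne'.isUnit, invOf_eq_inv]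
  rw [hinv, Matrix.smul_apply, smul_eq_mul] at h2
  have h3 := hsub i
  have h4 := hsol i
  have h5 : a i * (c⁻¹ * (interp S α b)⁻¹ i i) = 1 := by
    rw [hai, ← h4]; field_simp
  have := mul_lt_mul_of_pos_left (h2.trans_le h1) (ha i)
  linarith

theorem solution_unique {S : Matrix ι ι ℝ} (hS : S.PosDef) {α : ℝ} (hα : α ∈ Ico (0 : ℝ) 1)
    {a b : ι → ℝ} (ha : ∀ i, 0 < a i) (hb : ∀ i, 0 < b i)
    (hsa : ∀ i, a i * (interp S α a)⁻¹ i i = 1)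
    (hsb : ∀ i, b i * (interp S α b)⁻¹ i i = 1) : a = b :=
  funext fun i => le_antisymm (subsolution_le hS hα ha hb (fun i => (hsa i).le) hsb i)
    (subsolution_le hS hα hb ha (fun i => (hsb i).le) hsa i)

theorem inv_diagonal_of_pos {d : ι → ℝ} (hd : ∀ i, 0 < d i) :
    (diagonal d)⁻¹ = diagonal fun i => (d i)⁻¹ := by
  refine inv_eq_right_inv ?_
  rw [diagonal_mul_diagonal, ← diagonal_one]
  congr 1
  ext j
  exact mul_inv_cancel₀ (hd j).ne'

theorem inv_diagonal_diag {d : ι → ℝ} (hd : ∀ i, 0 < d i) (i : ι) :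
    (diagonal d)⁻¹ i i = (d i)⁻¹ := by
  rw [inv_diagonal_of_pos hd, diagonal_apply_eq]

/-- The solutions of the stationarity equations increase with the order, and strictly so in some
coordinate. -/
theorem solution_strictMono {S : Matrix ι ι ℝ} (hS : S.PosDef) (hdiag : ¬ S.IsDiag) {α β : ℝ}
    (hα : 0 ≤ α) (hαβ : α < β) (hβ : β < 1) {a b : ι → ℝ}
    (ha : ∀ i, 0 < a i) (hb : ∀ i, 0 < b i)
    (hsa : ∀ i, a i * (interp S α a)⁻¹ i i = 1)
    (hsb : ∀ i, b i * (interp S β b)⁻¹ i i = 1) : a < b := by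
  have hα1 : α < 1 := hαβ.trans hβ
  have hβ0 : 0 ≤ β := hα.trans hαβ.le
  have hr : (1 - β) / (1 - α) ∈ Ioo (0 : ℝ) 1 :=
    ⟨div_pos (by linarith) (by linarith), (div_lt_one (by linarith)).2 (by linarith)⟩
  have hM := posDef_interp hS ⟨hβ0, hβ.le⟩ ha
  have hA : (diagonal a).PosDef := PosDef.diagonal ha
  have hB := posDef_interp hS ⟨hα, hα1.le⟩ ha
  have hval : ∀ i, a i * ((1 - (1 - β) / (1 - α)) * (diagonal a)⁻¹ i i +
      (1 - β) / (1 - α) * (interp S α a)⁻¹ i i) = 1 := by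
    intro i
    have h1 : a i * (diagonal a)⁻¹ i i = 1 := by
      rw [inv_diagonal_diag ha]; exact mul_inv_cancel₀ (ha i).ne'
    linear_combination (1 - (1 - β) / (1 - α)) * h1 + (1 - β) / (1 - α) * hsa i
  -- Convexity along the segment from `diagonal a` to `interp S α a`: both endpoints satisfy the
  -- `i`-th equation exactly, so `a` is a subsolution at order `β`.
  have hle : ∀ i, a i * (interp S β a)⁻¹ i i ≤ 1 := by
    intro i
    rw [← hval i]
    refine mul_le_mul_of_nonneg_left ?_ (ha i).le
    rw [interp_reparam S hα1] at hM ⊢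
    exact inv_diag_convex hA hB ⟨hr.1.le, hr.2.le⟩ hM i
  refine lt_of_le_of_ne (subsolution_le hS ⟨hβ0, hβ⟩ ha hb hle hsb) ?_
  rintro rfl
  refine hdiag (isDiag_of_interp_eq hα1 (a := a) ?_)
  -- If `a` also solves the equations at order `β`, convexity is an equality for every `i`; strict
  -- convexity then forces the two inverses to agree column by column, making `S` diagonal.
  have hinv : (diagonal a)⁻¹ = (interp S α a)⁻¹ := by
    ext j i
    suffices (diagonal a)⁻¹ *ᵥ Pi.single i 1 = (interp S α a)⁻¹ *ᵥ Pi.single i 1 by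
      simpa using congrFun this j
    by_contra hne
    have hlt := mul_lt_mul_of_pos_left
      (inv_diag_strictConvex hA hB hr (by rwa [← interp_reparam S hα1]) hne) (ha i)
    rw [← interp_reparam S hα1, hval i, hsb i] at hlt
    exact lt_irrefl _ hlt
  rw [← nonsing_inv_nonsing_inv _ hA.det_pos.ne'.isUnit, hinv,
    nonsing_inv_nonsing_inv _ hB.det_pos.ne'.isUnit]

/-- The lower bound is convexity of inversion between `S` and `diagonal d`; the upper bound is `1 ≤
M i i * M⁻¹ i i` at `M = interp S α d`. The bounds depend neither on `α` nor on the other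
coordinates. -/
theorem solution_mem_Icc {S : Matrix ι ι ℝ} (hS : S.PosDef) {α : ℝ} (hα : α ∈ Ico (0 : ℝ) 1)
    {d : ι → ℝ} (hd : ∀ i, 0 < d i) {i : ι} (hi : d i * (interp S α d)⁻¹ i i = 1) :
    d i ∈ Icc (S⁻¹ i i)⁻¹ (S i i) := by
  have hM := posDef_interp hS ⟨hα.1, hα.2.le⟩ hd
  have h1 : 0 < 1 - α := sub_pos.2 hα.2
  have hinv : (interp S α d)⁻¹ i i = (d i)⁻¹ := eq_inv_of_mul_eq_one_right hi
  constructor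
  · have hD : (diagonal d).PosDef := PosDef.diagonal hd
    have h := inv_diag_convex hS hD ⟨hα.1, hα.2.le⟩ (by rwa [add_comm]) i
    rw [add_comm ((1 - α) • S)] at h
    change (interp S α d)⁻¹ i i ≤ _ at h
    rw [inv_diagonal_diag hd, hinv] at h
    have h' : (1 - α) * (d i)⁻¹ ≤ (1 - α) * S⁻¹ i i := by linarith
    exact inv_le_of_inv_le₀ (hd i) (le_of_mul_le_mul_left h' h1)
  · have h := one_le_diag_mul_inv_diag hM i
    rw [hinv, ← div_eq_mul_inv, one_le_div (hd i)] at h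
    simp only [interp, Matrix.add_apply, Matrix.smul_apply, diagonal_apply_eq, smul_eq_mul] at h
    have h' : (1 - α) * d i ≤ (1 - α) * S i i := by linarith
    exact le_of_mul_le_mul_left h' h1

/-! ### The objective and its minimization in one coordinate. -/

theorem adjugate_eq_det_mul_inv {M : Matrix ι ι ℝ} (hM : M.PosDef) :
    M.adjugate = M.det • M⁻¹ := by
  rw [inv_def, smul_smul, Ring.inverse_eq_inv', mul_inv_cancel₀ hM.det_pos.ne', one_smul]

theorem det_interp_update (S : Matrix ι ι ℝ) (α : ℝ) (d : ι → ℝ) (i : ι) (x : ℝ) :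
    (interp S α (Function.update d i x)).det =
      (interp S α d).det + α * (x - d i) * (interp S α d).adjugate i i := by
  rw [interp_update, det_updateRow_add, det_updateRow_smul, updateRow_eq_self, adjugate_apply]

theorem adjugate_interp_update (S : Matrix ι ι ℝ) (α : ℝ) (d : ι → ℝ) (i : ι) (x : ℝ) :
    (interp S α (Function.update d i x)).adjugate i i = (interp S α d).adjugate i i := by
  rw [adjugate_apply, adjugate_apply, interp_update, updateRow_idem]

/-- Up to an affine change, the logarithmic divergence as a function of the variances. -/
noncomputable def objective (S : Matrix ι ι ℝ) (α : ℝ) (d : ι → ℝ) : ℝ :=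
  Real.log (interp S α d).det - α * ∑ i, Real.log (d i)

/-- With `y` the `i`-th column of the inverse and `m = y i`, one has `m = α * (y ⬝ᵥ diagonal d *ᵥ y)
+ (1 - α) * (y ⬝ᵥ S *ᵥ y)`, which exceeds `α * d i * m ^ 2`. The bound makes the coordinate solution
below positive. -/
theorem mul_inv_interp_lt_one {S : Matrix ι ι ℝ} (hS : S.PosDef) {α : ℝ}
    (hα : α ∈ Ioo (0 : ℝ) 1) {d : ι → ℝ} (hd : ∀ i, 0 < d i) (i : ι) :
    α * d i * (interp S α d)⁻¹ i i < 1 := by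
  have hM := posDef_interp hS ⟨hα.1.le, hα.2.le⟩ hd
  have h := quadratic_eq_inv_diag hM i
  set m := (interp S α d)⁻¹ i i with hm
  have hmpos : 0 < m := hM.inv.diag_pos
  set y := (interp S α d)⁻¹ *ᵥ Pi.single i 1 with hy
  have hyi : y i = m := by simp [hy, hm]
  have hS' := hS.dotProduct_mulVec_pos (inv_mulVec_single_ne_zero hM i)
  rw [← hy, star_trivial] at hS'
  simp only [interp, add_mulVec, smul_mulVec, dotProduct_add, dotProduct_smul, smul_eq_mul,
    hyi] at h
  have h2 : d i * m ^ 2 ≤ y ⬝ᵥ diagonal d *ᵥ y := by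
    simp only [dotProduct, mulVec_diagonal]
    refine le_trans (le_of_eq ?_) (Finset.single_le_sum (f := fun j => y j * (d j * y j))
      (fun j _ => ?_) (Finset.mem_univ i))
    · rw [hyi]; ring
    · nlinarith [mul_nonneg (hd j).le (sq_nonneg (y j))]
  have h3 := mul_le_mul_of_nonneg_left h2 hα.1.le
  have h4 := mul_pos (sub_pos.2 hα.2) hS'
  have h5 : α * d i * m * m < 1 * m := by nlinarith
  exact lt_of_mul_lt_mul_right h5 hmpos.le

theorem exists_coordinate_solution {S : Matrix ι ι ℝ} (hS : S.PosDef) {α : ℝ}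
    (hα : α ∈ Ioo (0 : ℝ) 1) {d : ι → ℝ} (hd : ∀ i, 0 < d i) (i : ι) :
    ∃ x, 0 < x ∧ x * (interp S α (Function.update d i x))⁻¹ i i = 1 := by
  have hM := posDef_interp hS ⟨hα.1.le, hα.2.le⟩ hd
  have h := mul_inv_interp_lt_one hS hα hd i
  have hadj : (interp S α d).adjugate i i = (interp S α d).det * (interp S α d)⁻¹ i i := by
    rw [adjugate_eq_det_mul_inv hM]; rfl
  set m := (interp S α d)⁻¹ i i with hm
  have hmpos : 0 < m := hM.inv.diag_pos
  have h1 : 0 < 1 - α := sub_pos.2 hα.2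
  -- The updated determinant is the old one times `1 - α * d i * m + α * x * m`, while the cofactor
  -- at `i` is unchanged. Hence the stationarity equation is linear in `x`, and this is its root.
  set x := (1 - α * d i * m) / ((1 - α) * m) with hx
  have hx0 : 0 < x := div_pos (sub_pos.2 h) (mul_pos h1 hmpos)
  refine ⟨x, hx0, ?_⟩
  have hM' := posDef_interp hS ⟨hα.1.le, hα.2.le⟩ (update_pos hd i hx0)
  have hadj' : (interp S α (Function.update d i x)).adjugate i i =
      (interp S α (Function.update d i x)).det * (interp S α (Function.update d i x))⁻¹ i i := by
    rw [adjugate_eq_det_mul_inv hM']; rfl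
  rw [adjugate_interp_update, hadj] at hadj'
  have hdet := det_interp_update S α d i x
  rw [hadj] at hdet
  have hxm : (1 - α) * (x * m) = 1 - α * d i * m := by rw [hx]; field_simp
  have hkey : (interp S α (Function.update d i x)).det = (interp S α d).det * (x * m) := by
    rw [hdet]; linear_combination (-(interp S α d).det) * hxm
  rw [hkey] at hadj'
  have hdp := hM.det_pos
  have : (interp S α d).det * m ≠ 0 := (mul_pos hdp hmpos).ne'
  refine mul_left_cancel₀ this ?_
  rw [mul_one]
  linear_combination -hadj'

theorem log_weighted_lt {α u : ℝ} (hα : α ∈ Ioo (0 : ℝ) 1) (hu : 0 < u) (hu1 : u ≠ 1) :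
    α * Real.log u < Real.log (1 - α + α * u) := by
  have h := strictConcaveOn_log_Ioi.2 (mem_Ioi.2 hu) (mem_Ioi.2 one_pos) hu1 hα.1
    (sub_pos.2 hα.2) (by ring)
  simp only [smul_eq_mul, Real.log_one, mul_zero, add_zero, mul_one] at h
  rwa [add_comm (1 - α)]

/-- At a stationary coordinate, with `u = x / d i`, the update multiplies the determinant by `1 - α
+ α * u` and adds `log u` to the sum of logarithms. Strict concavity of the logarithm between `u`
and `1` decides the sign. -/
theorem objective_lt_of_coordinate_solution {S : Matrix ι ι ℝ} (hS : S.PosDef) {α : ℝ}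
    (hα : α ∈ Ioo (0 : ℝ) 1) {d : ι → ℝ} (hd : ∀ i, 0 < d i) {i : ι}
    (hi : d i * (interp S α d)⁻¹ i i = 1) {x : ℝ} (hx : 0 < x) (hne : x ≠ d i) :
    objective S α d < objective S α (Function.update d i x) := by
  have hM := posDef_interp hS ⟨hα.1.le, hα.2.le⟩ hd
  have hinv : (interp S α d)⁻¹ i i = (d i)⁻¹ := eq_inv_of_mul_eq_one_right hi
  have hdet : (interp S α (Function.update d i x)).det =
      (interp S α d).det * (1 - α + α * (x / d i)) := by
    rw [det_interp_update, adjugate_eq_det_mul_inv hM, Matrix.smul_apply, hinv, smul_eq_mul]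
    have := (hd i).ne'
    field_simp
    ring
  have hu : 0 < x / d i := div_pos hx (hd i)
  have hlog := log_weighted_lt hα hu (by rwa [Ne, div_eq_one_iff_eq (hd i).ne'])
  have hpos : 0 < 1 - α + α * (x / d i) :=
    add_pos (sub_pos.2 hα.2) (mul_pos hα.1 hu)
  have hsum : ∑ j, Real.log (Function.update d i x j) =
      ∑ j, Real.log (d j) + (Real.log x - Real.log (d i)) := by
    rw [← Finset.add_sum_erase _ _ (Finset.mem_univ i),
      ← Finset.add_sum_erase _ (fun j => Real.log (d j)) (Finset.mem_univ i)]
    rw [Finset.sum_congr rfl (g := fun j => Real.log (d j))]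
    · simp; ring
    · intro j hj
      rw [Function.update_of_ne (Finset.ne_of_mem_erase hj)]
  rw [objective, objective, hdet, hsum, Real.log_mul hM.det_pos.ne' hpos.ne']
  rw [Real.log_div hx.ne' (hd i).ne'] at hlog
  linarith

/-- Minimizing in a single coordinate lands in a fixed interval. -/
theorem exists_coordinate_minimizer {S : Matrix ι ι ℝ} (hS : S.PosDef) {α : ℝ}
    (hα : α ∈ Ioo (0 : ℝ) 1) {d : ι → ℝ} (hd : ∀ i, 0 < d i) (i : ι) :
    ∃ x ∈ Icc (S⁻¹ i i)⁻¹ (S i i), objective S α (Function.update d i x) ≤ objective S α d ∧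
      (d i * (interp S α d)⁻¹ i i ≠ 1 →
        objective S α (Function.update d i x) < objective S α d) := by
  obtain ⟨x, hx0, hx⟩ := exists_coordinate_solution hS hα hd i
  have hd' := update_pos hd i hx0
  have hsol : Function.update d i x i * (interp S α (Function.update d i x))⁻¹ i i = 1 := by
    simpa using hx
  have hmem := solution_mem_Icc hS ⟨hα.1.le, hα.2⟩ hd' hsol
  rw [Function.update_self] at hmem
  refine ⟨x, hmem, ?_⟩
  by_cases hxd : d i = x
  · have : Function.update d i x = d := by rw [← hxd]; exact Function.update_eq_self i d
    rw [this] at hsol ⊢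
    exact ⟨le_rfl, fun h => absurd hsol h⟩
  · have h := objective_lt_of_coordinate_solution hS hα hd' hsol (hd i)
      (by rwa [Function.update_self])
    rw [Function.update_idem, Function.update_eq_self] at h
    exact ⟨h.le, fun _ => h⟩

/-! ### Strict Hadamard inequalities. -/

/-- Strict form of Hadamard's determinant inequality when all diagonal entries are one. -/
theorem det_lt_one_of_diag_eq_one {N : Matrix ι ι ℝ} (hN : N.PosDef) (h1 : ∀ i, N i i = 1)
    (hne : N ≠ 1) : N.det < 1 := by
  have hpos := hN.eigenvalues_pos
  have htr : ∑ i, hN.1.eigenvalues i = Fintype.card ι := by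
    have := hN.1.trace_eq_sum_eigenvalues
    simp only [trace, diag_apply, h1] at this
    simpa using this.symm
  have hdet : N.det = ∏ i, hN.1.eigenvalues i := by
    simpa using hN.1.det_eq_prod_eigenvalues
  have hex : ∃ i, hN.1.eigenvalues i ≠ 1 := by
    by_contra! hall
    refine hne ?_
    rw [hN.1.spectral_theorem]
    have : hN.1.eigenvalues = fun _ => 1 := funext hall
    have h : (diagonal (RCLike.ofReal ∘ hN.1.eigenvalues) : Matrix ι ι ℝ) = 1 := by
      rw [this]; simp
    rw [h, map_one]
  obtain ⟨k, hk⟩ := hex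
  -- The right side sums to trace minus dimension, which is zero, so the log-determinant is
  -- negative.
  have hlog : ∑ i, Real.log (hN.1.eigenvalues i) < ∑ i, (hN.1.eigenvalues i - 1) :=
    Finset.sum_lt_sum (fun i _ => Real.log_le_sub_one_of_pos (hpos i))
      ⟨k, Finset.mem_univ k, Real.log_lt_sub_one_of_pos (hpos k) hk⟩
  rw [← Real.log_prod (fun i _ => (hpos i).ne'), ← hdet, Finset.sum_sub_distrib, htr] at hlog
  simp only [Finset.sum_const, Finset.card_univ, nsmul_eq_mul, mul_one, sub_self] at hlog
  exact (Real.log_neg_iff hN.det_pos).1 hlog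

/-- Strict form of Hadamard's determinant inequality. -/
theorem det_lt_prod_diag {S : Matrix ι ι ℝ} (hS : S.PosDef) (hdiag : ¬ S.IsDiag) :
    S.det < ∏ i, S i i := by
  have hp : ∀ i, 0 < S i i := fun i => hS.diag_pos
  set s : ι → ℝ := fun i => (Real.sqrt (S i i))⁻¹ with hs
  have hs0 : ∀ i, 0 < s i := fun i => inv_pos.2 (Real.sqrt_pos.2 (hp i))
  have hss : ∀ i, s i * s i = (S i i)⁻¹ := fun i => by
    rw [hs, ← mul_inv, Real.mul_self_sqrt (hp i).le]
  have hN : (diagonal s * S * diagonal s).PosDef := by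
    have := hS.conjTranspose_mul_mul_same (B := diagonal s)
      (mulVec_injective_of_isUnit (PosDef.diagonal hs0).isUnit)
    simpa using this
  have hentry : ∀ i j, (diagonal s * S * diagonal s) i j = s i * S i j * s j := fun i j => by
    rw [mul_diagonal, diagonal_mul]
  have hlt := det_lt_one_of_diag_eq_one hN (fun i => by
    rw [hentry, mul_right_comm, hss, inv_mul_cancel₀ (hp i).ne']) (fun h => hdiag fun i j hij => by
      have := congrFun (congrFun h i) j
      rw [hentry, one_apply_ne hij] at this
      have h1 := (hs0 i).ne'
      have h2 := (hs0 j).ne'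
      simpa [h1, h2] using this)
  have hdet : (diagonal s * S * diagonal s).det = S.det / ∏ i, S i i := by
    rw [det_mul, det_mul, det_diagonal, div_eq_mul_inv, ← Finset.prod_inv_distrib]
    simp_rw [← hss]
    rw [Finset.prod_mul_distrib]
    ring
  rwa [hdet, div_lt_one (Finset.prod_pos fun i _ => hp i)] at hlt

/-- Hadamard's inequality applied to `S⁻¹`, which is not diagonal either. It settles the endpoint `α
= 0`, as the inequality for `S` settles `α = 1`. -/
theorem prod_inv_diag_lt_det {S : Matrix ι ι ℝ} (hS : S.PosDef) (hdiag : ¬ S.IsDiag) :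
    ∏ i, (S⁻¹ i i)⁻¹ < S.det := by
  have hS' : ¬ S⁻¹.IsDiag := fun h => hdiag <| by
    have h2 : S⁻¹⁻¹ = diagonal (Ring.inverse (diag S⁻¹)) := by
      conv_lhs => rw [← h.diagonal_diag]
      exact inv_diagonal _
    rw [nonsing_inv_nonsing_inv _ hS.det_pos.ne'.isUnit] at h2
    rw [h2]
    exact isDiag_diagonal _
  have h := det_lt_prod_diag hS.inv hS'
  rw [det_nonsing_inv, Ring.inverse_eq_inv'] at h
  rw [Finset.prod_inv_distrib]
  exact inv_lt_of_inv_lt₀ hS.det_pos h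

theorem inv_diag_le_diag {S : Matrix ι ι ℝ} (hS : S.PosDef) (i : ι) : (S⁻¹ i i)⁻¹ ≤ S i i := by
  have hP : 0 < S⁻¹ i i := hS.inv.diag_pos
  exact (inv_le_iff_one_le_mul₀ hP).2 (one_le_diag_mul_inv_diag hS i)

/-! ### Existence and uniqueness of the minimizer. -/

/-- One sweep of coordinatewise minimization. The interval for a coordinate does not depend on the
others, so coordinates already treated stay in the box. -/
theorem exists_mem_box_objective_le {S : Matrix ι ι ℝ} (hS : S.PosDef) {α : ℝ}
    (hα : α ∈ Ioo (0 : ℝ) 1) {d : ι → ℝ} (hd : ∀ i, 0 < d i) :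
    ∃ e : ι → ℝ, (∀ i, e i ∈ Icc (S⁻¹ i i)⁻¹ (S i i)) ∧ objective S α e ≤ objective S α d := by
  suffices h : ∀ s : Finset ι, ∃ e : ι → ℝ, (∀ i, 0 < e i) ∧
      (∀ i ∈ s, e i ∈ Icc (S⁻¹ i i)⁻¹ (S i i)) ∧ objective S α e ≤ objective S α d by
    obtain ⟨e, -, he, hle⟩ := h Finset.univ
    exact ⟨e, fun i => he i (Finset.mem_univ i), hle⟩
  intro s
  induction s using Finset.induction_on with
  | empty => exact ⟨d, hd, by simp, le_rfl⟩
  | insert i s _ ih =>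
    obtain ⟨e, he0, he, hle⟩ := ih
    obtain ⟨x, hx, hxle, -⟩ := exists_coordinate_minimizer hS hα he0 i
    have hx0 : 0 < x := lt_of_lt_of_le (inv_pos.2 hS.inv.diag_pos) hx.1
    refine ⟨Function.update e i x, update_pos he0 i hx0, fun j hj => ?_, hxle.trans hle⟩
    by_cases hji : j = i
    · subst hji; simpa using hx
    · rw [Function.update_of_ne hji]
      exact he j ((Finset.mem_insert.1 hj).resolve_left hji)

theorem minimizer_is_solution {S : Matrix ι ι ℝ} (hS : S.PosDef) {α : ℝ}
    (hα : α ∈ Ioo (0 : ℝ) 1) {d : ι → ℝ} (hd : ∀ i, 0 < d i)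
    (hmin : ∀ e : ι → ℝ, (∀ i, 0 < e i) → objective S α d ≤ objective S α e) (i : ι) :
    d i * (interp S α d)⁻¹ i i = 1 := by
  obtain ⟨x, hx, -, hlt⟩ := exists_coordinate_minimizer hS hα hd i
  by_contra hne
  exact (hlt hne).not_ge
    (hmin _ (update_pos hd i (lt_of_lt_of_le (inv_pos.2 hS.inv.diag_pos) hx.1)))

/-- The objective has a unique minimizer, and it solves the stationarity equations. -/
theorem exists_minimizer {S : Matrix ι ι ℝ} (hS : S.PosDef) {α : ℝ}
    (hα : α ∈ Ioo (0 : ℝ) 1) : ∃ d : ι → ℝ, (∀ i, 0 < d i) ∧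
      (∀ i, d i * (interp S α d)⁻¹ i i = 1) ∧
      ∀ e : ι → ℝ, (∀ i, 0 < e i) → e ≠ d → objective S α d < objective S α e := by
  set K : Set (ι → ℝ) := Icc (fun i => (S⁻¹ i i)⁻¹) (fun i => S i i) with hK
  have hpos : ∀ d ∈ K, ∀ i, 0 < d i := fun d hd i =>
    lt_of_lt_of_le (inv_pos.2 hS.inv.diag_pos) (hd.1 i)
  have hcont : ContinuousOn (objective S α) K := by
    unfold objective
    refine ContinuousOn.sub (ContinuousOn.log ?_ ?_) (ContinuousOn.mul continuousOn_const
      (continuousOn_finsetSum _ fun i _ => ContinuousOn.log ?_ ?_))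
    · exact ((continuous_interp S).comp (Continuous.prodMk_right α)).matrix_det.continuousOn
    · exact fun d hd => (posDef_interp hS ⟨hα.1.le, hα.2.le⟩ (hpos d hd)).det_pos.ne'
    · exact (continuous_apply i).continuousOn
    · exact fun d hd => (hpos d hd i).ne'
  have hne : K.Nonempty := by
    exact nonempty_Icc.2 (inv_diag_le_diag hS)
  obtain ⟨d, hdK, hd⟩ := isCompact_Icc.exists_isMinOn hne hcont
  have hmin : ∀ e : ι → ℝ, (∀ i, 0 < e i) → objective S α d ≤ objective S α e := fun e he => by
    obtain ⟨f, hf, hle⟩ := exists_mem_box_objective_le hS hα he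
    exact (hd (show f ∈ K from ⟨fun i => (hf i).1, fun i => (hf i).2⟩)).trans hle
  refine ⟨d, hpos d hdK, minimizer_is_solution hS hα (hpos d hdK) hmin, fun e he hne => ?_⟩
  refine lt_of_le_of_ne (hmin e he) fun heq => hne ?_
  -- A second minimizer would also solve the stationarity equations.
  exact solution_unique hS ⟨hα.1.le, hα.2⟩ he (hpos d hdK)
    (minimizer_is_solution hS hα he (heq ▸ hmin)) (minimizer_is_solution hS hα (hpos d hdK) hmin)

/-! ### Solutions over the closed interval of orders, and the matching order. -/

/-- A compact set over `[0, 1]` whose fibres are the solutions of the stationarity equations. The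
two equations are equivalent for orders in `(0, 1)`, but each is vacuous at one endpoint. -/
def solutionSet (S : Matrix ι ι ℝ) : Set (ℝ × (ι → ℝ)) :=
  Icc (0 : ℝ) 1 ×ˢ Icc (fun i => (S⁻¹ i i)⁻¹) (fun i => S i i) ∩
    {p | ∀ i, p.2 i * (interp S p.1 p.2).adjugate i i = (interp S p.1 p.2).det ∧
      (S * (interp S p.1 p.2).adjugate) i i = (interp S p.1 p.2).det}

/-- With adjugate and determinant in place of the inverse, the equations are polynomial in the order
and the variances, hence closed conditions on a compact box. -/
theorem isCompact_solutionSet (S : Matrix ι ι ℝ) : IsCompact (solutionSet S) := by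
  refine (isCompact_Icc.prod isCompact_Icc).inter_right ?_
  rw [ofPred_forall]
  have hc := continuous_interp S
  refine isClosed_iInter fun i => (isClosed_eq ?_ ?_).inter (isClosed_eq ?_ ?_)
  · exact ((continuous_apply i).comp continuous_snd).mul (hc.matrix_adjugate.matrix_elem i i)
  · exact hc.matrix_det
  · exact (continuous_const.matrix_mul hc.matrix_adjugate).matrix_elem i i
  · exact hc.matrix_det

theorem solutionSet_pos {S : Matrix ι ι ℝ} (hS : S.PosDef) {p : ℝ × (ι → ℝ)}
    (hp : p ∈ solutionSet S) (i : ι) : 0 < p.2 i :=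
  lt_of_lt_of_le (inv_pos.2 hS.inv.diag_pos) (hp.1.2.1 i)

theorem solution_of_mem_solutionSet {S : Matrix ι ι ℝ} (hS : S.PosDef) {α : ℝ} {d : ι → ℝ}
    (hp : (α, d) ∈ solutionSet S) (i : ι) :
    d i * (interp S α d)⁻¹ i i = 1 ∧ (S * (interp S α d)⁻¹) i i = 1 := by
  have hM := posDef_interp hS hp.1.1 (solutionSet_pos hS hp)
  obtain ⟨h1, h2⟩ := hp.2 i
  simp only [adjugate_eq_det_mul_inv hM, Matrix.mul_smul, Matrix.smul_apply, smul_eq_mul] at h1 h2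
  have hne := hM.det_pos.ne'
  exact ⟨mul_left_cancel₀ hne (by linear_combination h1),
    mul_left_cancel₀ hne (by linear_combination h2)⟩

theorem mem_solutionSet {S : Matrix ι ι ℝ} (hS : S.PosDef) {α : ℝ} (hα : α ∈ Icc (0 : ℝ) 1)
    {d : ι → ℝ} (hd : d ∈ Icc (fun i => (S⁻¹ i i)⁻¹) (fun i => S i i))
    (h1 : ∀ i, d i * (interp S α d)⁻¹ i i = 1) (h2 : ∀ i, (S * (interp S α d)⁻¹) i i = 1) :
    (α, d) ∈ solutionSet S := by
  have hd0 : ∀ i, 0 < d i := fun i => lt_of_lt_of_le (inv_pos.2 hS.inv.diag_pos) (hd.1 i)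
  have hM := posDef_interp hS hα hd0
  refine ⟨⟨hα, hd⟩, fun i => ?_⟩
  simp only [adjugate_eq_det_mul_inv hM, Matrix.mul_smul, Matrix.smul_apply, smul_eq_mul]
  exact ⟨by linear_combination (interp S α d).det * h1 i,
    by linear_combination (interp S α d).det * h2 i⟩

theorem exists_mem_solutionSet {S : Matrix ι ι ℝ} (hS : S.PosDef) {α : ℝ}
    (hα : α ∈ Icc (0 : ℝ) 1) : ∃ d, (α, d) ∈ solutionSet S := by
  rcases hα.1.eq_or_lt with h0 | h0
  · subst h0
    have hI : ∀ d, interp S 0 d = S := fun d => by simp [interp]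
    refine ⟨fun i => (S⁻¹ i i)⁻¹, mem_solutionSet hS hα ⟨le_rfl, inv_diag_le_diag hS⟩
      (fun i => ?_) (fun i => ?_)⟩
    · rw [hI]
      exact inv_mul_cancel₀ (hS.inv.diag_pos (i := i)).ne'
    · rw [hI, mul_nonsing_inv _ hS.det_pos.ne'.isUnit, one_apply_eq]
  rcases hα.2.eq_or_lt with h1 | h1
  · subst h1
    have hI : ∀ d, interp S 1 d = diagonal d := fun d => by simp [interp]
    have hp : ∀ i, 0 < S i i := fun i => hS.diag_pos
    have hinv := inv_diagonal_of_pos hp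
    refine ⟨fun i => S i i, mem_solutionSet hS hα ⟨inv_diag_le_diag hS, le_rfl⟩
      (fun i => ?_) (fun i => ?_)⟩
    · rw [hI, hinv, diagonal_apply_eq]
      exact mul_inv_cancel₀ (hp i).ne'
    · rw [hI, hinv, mul_diagonal]
      exact mul_inv_cancel₀ (hp i).ne'
  obtain ⟨d, hd, hsol, -⟩ := exists_minimizer hS ⟨h0, h1⟩
  have hmem := fun i => solution_mem_Icc hS ⟨hα.1, h1⟩ hd (hsol i)
  refine ⟨d, mem_solutionSet hS hα ⟨fun i => (hmem i).1, fun i => (hmem i).2⟩ hsol fun i => ?_⟩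
  have hM := posDef_interp hS hα hd
  -- Expanding `M * M⁻¹ = 1` on the diagonal shows that `α` times the first stationarity expression
  -- plus `1 - α` times the second equals `1`, so for `α < 1` the first equation implies the second.
  have h : (interp S α d * (interp S α d)⁻¹) i i = 1 := by
    rw [mul_nonsing_inv _ hM.det_pos.ne'.isUnit, one_apply_eq]
  conv at h =>
    lhs
    rw [interp, Matrix.add_mul, Matrix.smul_mul, Matrix.smul_mul]
  simp only [Matrix.add_apply, Matrix.smul_apply, smul_eq_mul, diagonal_mul] at h
  change α * (d i * (interp S α d)⁻¹ i i) + (1 - α) * (S * (interp S α d)⁻¹) i i = 1 at h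
  rw [hsol i] at h
  exact mul_left_cancel₀ (sub_pos.2 h1).ne' (by linear_combination h)

/-- Some order in `(0, 1)` has a solution of the stationarity equations matching the
determinant of `S`. -/
theorem exists_order_prod_eq_det {S : Matrix ι ι ℝ} (hS : S.PosDef) (hdiag : ¬ S.IsDiag) :
    ∃ α ∈ Ioo (0 : ℝ) 1, ∃ d : ι → ℝ, (∀ i, 0 < d i) ∧
      (∀ i, d i * (interp S α d)⁻¹ i i = 1) ∧ ∏ i, d i = S.det := by
  have hprod : Continuous fun p : ℝ × (ι → ℝ) => ∏ i, p.2 i :=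
    continuous_finsetProd _ fun i _ => (continuous_apply i).comp continuous_snd
  -- The orders with a solution of product at most, respectively at least, `det S`. As projections
  -- of compact sets they are closed, so connectedness of the interval replaces continuity of the
  -- solution in the order.
  set U := Prod.fst '' (solutionSet S ∩ {p | ∏ i, p.2 i ≤ S.det}) with hU
  set V := Prod.fst '' (solutionSet S ∩ {p | S.det ≤ ∏ i, p.2 i}) with hV
  have hUc : IsClosed U := (((isCompact_solutionSet S).inter_right
    (isClosed_le hprod continuous_const)).image continuous_fst).isClosed
  have hVc : IsClosed V := (((isCompact_solutionSet S).inter_right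
    (isClosed_le continuous_const hprod)).image continuous_fst).isClosed
  have hzero : ∀ d, ((0 : ℝ), d) ∈ solutionSet S → ∏ i, d i < S.det := fun d hd => by
    refine lt_of_eq_of_lt (Finset.prod_congr rfl fun i _ => ?_) (prod_inv_diag_lt_det hS hdiag)
    have h := (solution_of_mem_solutionSet hS hd i).1
    have hI : interp S 0 d = S := by simp [interp]
    rw [hI] at h
    exact eq_inv_of_mul_eq_one_left h
  have hone : ∀ d, ((1 : ℝ), d) ∈ solutionSet S → S.det < ∏ i, d i := fun d hd => by
    refine lt_of_lt_of_eq (det_lt_prod_diag hS hdiag) (Finset.prod_congr rfl fun i _ => ?_)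
    have hpos := solutionSet_pos hS hd
    have h := (solution_of_mem_solutionSet hS hd i).2
    have hI : interp S 1 d = diagonal d := by simp [interp]
    have hinv := inv_diagonal_of_pos hpos
    rw [hI, hinv, mul_diagonal, ← div_eq_mul_inv, div_eq_one_iff_eq (hpos i).ne'] at h
    exact h
  have hcover : Icc (0 : ℝ) 1 ⊆ U ∪ V := fun α hα => by
    obtain ⟨d, hd⟩ := exists_mem_solutionSet hS hα
    rcases le_total (∏ i, d i) S.det with h | h
    · exact Or.inl ⟨(α, d), ⟨hd, h⟩, rfl⟩
    · exact Or.inr ⟨(α, d), ⟨hd, h⟩, rfl⟩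
  have h0 : (0 : ℝ) ∈ Icc (0 : ℝ) 1 := ⟨le_rfl, zero_le_one⟩
  have h1 : (1 : ℝ) ∈ Icc (0 : ℝ) 1 := ⟨zero_le_one, le_rfl⟩
  have hUne : (Icc (0 : ℝ) 1 ∩ U).Nonempty := by
    obtain ⟨d, hd⟩ := exists_mem_solutionSet hS h0
    exact ⟨0, h0, (0, d), ⟨hd, (hzero d hd).le⟩, rfl⟩
  have hVne : (Icc (0 : ℝ) 1 ∩ V).Nonempty := by
    obtain ⟨d, hd⟩ := exists_mem_solutionSet hS h1
    exact ⟨1, h1, (1, d), ⟨hd, (hone d hd).le⟩, rfl⟩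
  obtain ⟨α, hα, ⟨⟨_, d⟩, ⟨hd, hdle⟩, rfl⟩, ⟨⟨β, e⟩, ⟨he, hele⟩, hβ⟩⟩ :=
    isPreconnected_closed_iff.1 isPreconnected_Icc U V hUc hVc hcover hUne hVne
  simp only at hα hβ
  subst hβ
  have hα0 : β ≠ 0 := fun h => (hzero e (h ▸ he)).not_ge hele
  have hα1 : β ≠ 1 := fun h => (hone d (h ▸ hd)).not_ge hdle
  have hβ : β ∈ Ioo (0 : ℝ) 1 := ⟨lt_of_le_of_ne hα.1 hα0.symm, lt_of_le_of_ne hα.2 hα1⟩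
  have hsd := fun i => (solution_of_mem_solutionSet hS hd i).1
  have hse := fun i => (solution_of_mem_solutionSet hS he i).1
  -- The common order may carry one solution from `U` and another from `V`; uniqueness identifies
  -- them and gives equality of the product with `det S`.
  have hde : d = e := solution_unique hS ⟨hα.1, hβ.2⟩ (solutionSet_pos hS hd)
    (solutionSet_pos hS he) hsd hse
  subst hde
  exact ⟨β, hβ, d, solutionSet_pos hS hd, hsd, le_antisymm hdle hele⟩

end Stationarity

/-! ### Gaussian densities, entropy and generalized variance. -/

section Gaussian

open scoped MatrixOrder

variable {n : ℕ}

/-- The logarithm of the Lebesgue density of the Gaussian with mean `μ` and covariance `S`. -/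
noncomputable def gaussianLogDensity (μ : EuclideanSpace ℝ (Fin n)) (S : Matrix (Fin n) (Fin n) ℝ)
    (z : EuclideanSpace ℝ (Fin n)) : ℝ :=
  -(n / 2 * Real.log (2 * Real.pi)) - 1 / 2 * Real.log S.det
    - 1 / 2 * ((z - μ).ofLp ⬝ᵥ S⁻¹ *ᵥ (z - μ).ofLp)

theorem continuous_gaussianLogDensity (μ : EuclideanSpace ℝ (Fin n))
    (S : Matrix (Fin n) (Fin n) ℝ) : Continuous (gaussianLogDensity μ S) := by
  unfold gaussianLogDensity
  have h : Continuous fun z : EuclideanSpace ℝ (Fin n) => (z - μ).ofLp := by fun_prop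
  exact continuous_const.sub (continuous_const.mul
    (h.dotProduct (continuous_const.matrix_mulVec h)))

theorem dotProduct_self_eq_norm_sq (x : EuclideanSpace ℝ (Fin n)) :
    x.ofLp ⬝ᵥ x.ofLp = ‖x‖ ^ 2 := by
  rw [EuclideanSpace.real_norm_sq_eq, dotProduct]
  exact Finset.sum_congr rfl fun i _ => (sq _).symm

theorem gaussianLogDensity_zero_one (x : EuclideanSpace ℝ (Fin n)) :
    gaussianLogDensity 0 1 x = -(n / 2 * Real.log (2 * Real.pi)) - 1 / 2 * ‖x‖ ^ 2 := by
  simp [gaussianLogDensity, dotProduct_self_eq_norm_sq]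

theorem integrable_exp_gaussianLogDensity_zero_one :
    Integrable fun x : EuclideanSpace ℝ (Fin n) => Real.exp (gaussianLogDensity 0 1 x) := by
  have h := (GaussianFourier.integrable_cexp_neg_mul_sq_norm_add (b := (1 / 2 : ℂ))
    (by norm_num) 0 (0 : EuclideanSpace ℝ (Fin n))).re
  refine (h.const_mul (Real.exp (-(n / 2 * Real.log (2 * Real.pi))))).congr
    (Filter.Eventually.of_forall fun x => ?_)
  have : (-(1 / 2 : ℂ) * (‖x‖ : ℂ) ^ 2 + 0 * ((inner ℝ 0 x : ℝ) : ℂ)) =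
      ((-(1 / 2) * ‖x‖ ^ 2 : ℝ) : ℂ) := by push_cast; ring
  simp only [this]
  rw [gaussianLogDensity_zero_one, sub_eq_add_neg, Real.exp_add, ← Complex.ofReal_exp,
    RCLike.re_to_complex, Complex.ofReal_re, neg_mul]

/-- Both are finite measures with the same characteristic function, by the Fourier integral of a
Gaussian. -/
theorem stdGaussian_eq_withDensity :
    stdGaussian (EuclideanSpace ℝ (Fin n)) =
      volume.withDensity fun x => ENNReal.ofReal (Real.exp (gaussianLogDensity 0 1 x)) := by
  have hm : Measurable fun x : EuclideanSpace ℝ (Fin n) =>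
      ENNReal.ofReal (Real.exp (gaussianLogDensity 0 1 x)) :=
    (Real.continuous_exp.comp (continuous_gaussianLogDensity 0 1)).measurable.ennreal_ofReal
  have : IsFiniteMeasure ((volume : Measure (EuclideanSpace ℝ (Fin n))).withDensity
      fun x => ENNReal.ofReal (Real.exp (gaussianLogDensity 0 1 x))) :=
    isFiniteMeasure_withDensity_ofReal integrable_exp_gaussianLogDensity_zero_one.2
  refine Measure.ext_of_charFun (funext fun t => ?_)
  rw [charFun_stdGaussian, charFun_apply,
    integral_withDensity_eq_integral_toReal_smul hm (by simp)]
  have h := GaussianFourier.integral_cexp_neg_mul_sq_norm_add (b := (1 / 2 : ℂ))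
    (by norm_num) Complex.I t
  have hcongr : ∀ x : EuclideanSpace ℝ (Fin n),
      (ENNReal.ofReal (Real.exp (gaussianLogDensity 0 1 x))).toReal •
        Complex.exp (((inner ℝ x t : ℝ) : ℂ) * Complex.I) =
      Complex.exp (-(n / 2 * Real.log (2 * Real.pi)) : ℝ) *
        Complex.exp (-(1 / 2) * (‖x‖ : ℂ) ^ 2 + Complex.I * ((inner ℝ t x : ℝ) : ℂ)) := by
    intro x
    rw [ENNReal.toReal_ofReal (Real.exp_pos _).le, gaussianLogDensity_zero_one,
      Complex.real_smul, Complex.ofReal_exp, ← Complex.exp_add, ← Complex.exp_add,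
      real_inner_comm]
    congr 1
    push_cast
    ring
  simp_rw [hcongr]
  rw [integral_const_mul, h]
  have hpi : ((Real.pi : ℂ) / (1 / 2)) = ((2 * Real.pi : ℝ) : ℂ) := by push_cast; ring
  have hpow : ((Real.pi : ℂ) / (1 / 2)) ^
      ((Module.finrank ℝ (EuclideanSpace ℝ (Fin n)) : ℂ) / 2) =
      Complex.exp ((n / 2 * Real.log (2 * Real.pi) : ℝ) : ℂ) := by
    rw [hpi, Complex.cpow_def_of_ne_zero (by
      exact_mod_cast (mul_pos two_pos Real.pi_pos).ne'), ← Complex.ofReal_log (by positivity)]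
    congr 1
    simp
    ring
  rw [hpow, ← Complex.exp_add, ← Complex.exp_add, Complex.I_sq]
  congr 1
  push_cast
  ring

theorem det_sqrt_of_posDef {S : Matrix (Fin n) (Fin n) ℝ} (hS : S.PosDef) :
    (CFC.sqrt S).det = Real.sqrt S.det := by
  simpa using hS.posSemidef.det_sqrt

theorem det_toEuclideanCLM (A : Matrix (Fin n) (Fin n) ℝ) :
    (toEuclideanCLM (𝕜 := ℝ) A).det = A.det := by
  exact LinearMap.det_toLpLin 2 A

theorem quadratic_sqrt {S : Matrix (Fin n) (Fin n) ℝ} (hS : S.PosDef)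
    (x : EuclideanSpace ℝ (Fin n)) :
    (toEuclideanCLM (𝕜 := ℝ) (CFC.sqrt S) x).ofLp ⬝ᵥ
      S⁻¹ *ᵥ (toEuclideanCLM (𝕜 := ℝ) (CFC.sqrt S) x).ofLp = ‖x‖ ^ 2 := by
  have hsq : CFC.sqrt S * CFC.sqrt S = S := CFC.sqrt_mul_sqrt_self _ hS.posSemidef.nonneg
  have hdet : IsUnit (CFC.sqrt S).det := by
    rw [det_sqrt_of_posDef hS]; exact (Real.sqrt_pos.2 hS.det_pos).ne'.isUnit
  have hT : (CFC.sqrt S)ᵀ = CFC.sqrt S := by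
    simpa using (nonneg_iff_posSemidef.1 (CFC.sqrt_nonneg S)).isHermitian.eq
  have hone : CFC.sqrt S * (S⁻¹ * CFC.sqrt S) = 1 := by
    have : S⁻¹ = (CFC.sqrt S)⁻¹ * (CFC.sqrt S)⁻¹ := by
      conv_lhs => rw [← hsq]
      exact Matrix.mul_inv_rev _ _
    rw [this, Matrix.mul_assoc, nonsing_inv_mul _ hdet, Matrix.mul_one, mul_nonsing_inv _ hdet]
  rw [ofLp_toEuclideanCLM, mulVec_mulVec, dotProduct_comm, dotProduct_mulVec, ← mulVec_transpose,
    hT, mulVec_mulVec, hone, one_mulVec, dotProduct_self_eq_norm_sq]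

theorem gaussianLogDensity_affine {S : Matrix (Fin n) (Fin n) ℝ} (hS : S.PosDef)
    (μ x : EuclideanSpace ℝ (Fin n)) :
    gaussianLogDensity μ S (μ + toEuclideanCLM (𝕜 := ℝ) (CFC.sqrt S) x) =
      -(n / 2 * Real.log (2 * Real.pi)) - 1 / 2 * Real.log S.det - 1 / 2 * ‖x‖ ^ 2 := by
  rw [gaussianLogDensity, add_sub_cancel_left, quadratic_sqrt hS]

/-- Change of variables along `x ↦ μ + √S x`, whose Jacobian `√(det S)` cancels the normalizing
factor of the density. -/
theorem multivariateGaussian_eq_withDensity {S : Matrix (Fin n) (Fin n) ℝ} (hS : S.PosDef)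
    (μ : EuclideanSpace ℝ (Fin n)) :
    multivariateGaussian μ S =
      volume.withDensity fun x => ENNReal.ofReal (Real.exp (gaussianLogDensity μ S x)) := by
  set L := toEuclideanCLM (𝕜 := ℝ) (CFC.sqrt S) with hL
  have hdet : (CFC.sqrt S).det = Real.sqrt S.det := det_sqrt_of_posDef hS
  have hsqrt : 0 < Real.sqrt S.det := Real.sqrt_pos.2 hS.det_pos
  have hu : IsUnit (CFC.sqrt S).det := by rw [hdet]; exact hsqrt.ne'.isUnit
  have hleft : ∀ x, toEuclideanCLM (𝕜 := ℝ) (CFC.sqrt S)⁻¹ (L x) = x := fun x => by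
    rw [hL, ← mul_apply_eq_comp, ← map_mul, nonsing_inv_mul _ hu, map_one]; rfl
  have hright : ∀ x, L (toEuclideanCLM (𝕜 := ℝ) (CFC.sqrt S)⁻¹ x) = x := fun x => by
    rw [hL, ← mul_apply_eq_comp, ← map_mul, mul_nonsing_inv _ hu, map_one]; rfl
  have hinj : Function.Injective fun x => μ + L x := fun x y hxy => by
    rw [← hleft x, add_left_cancel hxy, hleft]
  have hsurj : Function.Surjective fun x => μ + L x := fun y =>
    ⟨toEuclideanCLM (𝕜 := ℝ) (CFC.sqrt S)⁻¹ (y - μ), by simp [hright]⟩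
  have hmeas : Measurable fun x => μ + L x := by fun_prop
  ext B hB
  rw [multivariateGaussian, Measure.map_apply hmeas hB, stdGaussian_eq_withDensity,
    withDensity_apply _ (hmeas hB), withDensity_apply _ hB]
  conv_rhs => rw [← image_preimage_eq B hsurj]
  rw [lintegral_image_eq_lintegral_abs_det_fderiv_mul volume (hmeas hB)
    (f' := fun _ => L) (fun x _ => (L.hasFDerivAt.const_add μ).hasFDerivWithinAt) hinj.injOn]
  refine lintegral_congr fun x => ?_
  rw [hL, det_toEuclideanCLM, hdet, abs_of_pos hsqrt, ← ENNReal.ofReal_mul hsqrt.le,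
    gaussianLogDensity_affine hS, gaussianLogDensity_zero_one]
  congr 1
  have : Real.sqrt S.det = Real.exp (1 / 2 * Real.log S.det) := by
    rw [Real.sqrt_eq_rpow, Real.rpow_def_of_pos hS.det_pos, mul_comm]
  rw [this, ← Real.exp_add]
  congr 1
  ring

theorem density_multivariateGaussian {S : Matrix (Fin n) (Fin n) ℝ} (hS : S.PosDef)
    (μ : EuclideanSpace ℝ (Fin n)) :
    density (multivariateGaussian μ S) =ᵐ[volume] fun z => Real.exp (gaussianLogDensity μ S z) := by
  have hm : Measurable fun x : EuclideanSpace ℝ (Fin n) =>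
      ENNReal.ofReal (Real.exp (gaussianLogDensity μ S x)) :=
    (Real.continuous_exp.comp (continuous_gaussianLogDensity μ S)).measurable.ennreal_ofReal
  rw [multivariateGaussian_eq_withDensity hS μ]
  filter_upwards [Measure.rnDeriv_withDensity volume hm] with z hz
  rw [density, hz, ENNReal.toReal_ofReal (Real.exp_pos _).le]

theorem lintegral_exp_gaussianLogDensity {S : Matrix (Fin n) (Fin n) ℝ} (hS : S.PosDef)
    (μ : EuclideanSpace ℝ (Fin n)) :
    ∫⁻ z, ENNReal.ofReal (Real.exp (gaussianLogDensity μ S z)) = 1 := by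
  have h : multivariateGaussian μ S univ = 1 := measure_univ
  rwa [multivariateGaussian_eq_withDensity hS μ, withDensity_apply _ MeasurableSet.univ,
    setLIntegral_univ] at h

theorem integrable_exp_gaussianLogDensity {S : Matrix (Fin n) (Fin n) ℝ} (hS : S.PosDef)
    (μ : EuclideanSpace ℝ (Fin n)) :
    Integrable fun z => Real.exp (gaussianLogDensity μ S z) := by
  refine ⟨(Real.continuous_exp.comp
    (continuous_gaussianLogDensity μ S)).aestronglyMeasurable, ?_⟩
  rw [hasFiniteIntegral_iff_ofReal (Filter.Eventually.of_forall fun z => (Real.exp_pos _).le),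
    lintegral_exp_gaussianLogDensity hS]
  exact ENNReal.one_lt_top

theorem integral_exp_gaussianLogDensity {S : Matrix (Fin n) (Fin n) ℝ} (hS : S.PosDef)
    (μ : EuclideanSpace ℝ (Fin n)) :
    ∫ z, Real.exp (gaussianLogDensity μ S z) = 1 := by
  rw [integral_eq_lintegral_of_nonneg_ae (Filter.Eventually.of_forall fun z => (Real.exp_pos _).le)
    (integrable_exp_gaussianLogDensity hS μ).1, lintegral_exp_gaussianLogDensity hS]
  rfl

/-- The entropy of a nondegenerate Gaussian is, up to a dimensional constant, half the logarithm
of the determinant of its covariance. -/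
theorem entropy_multivariateGaussian {S : Matrix (Fin n) (Fin n) ℝ} (hS : S.PosDef)
    (μ : EuclideanSpace ℝ (Fin n)) :
    entropy (multivariateGaussian μ S) = 1 / 2 * Real.log S.det + (n / 2 * Real.log (2 * Real.pi) +
      1 / 2 * ∫ x, ‖x‖ ^ 2 ∂(stdGaussian (EuclideanSpace ℝ (Fin n)))) := by
  have hm : Measurable fun x : EuclideanSpace ℝ (Fin n) =>
      ENNReal.ofReal (Real.exp (gaussianLogDensity μ S x)) :=
    (Real.continuous_exp.comp (continuous_gaussianLogDensity μ S)).measurable.ennreal_ofReal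
  have h1 : ∫ z, density (multivariateGaussian μ S) z *
      Real.log (density (multivariateGaussian μ S) z) =
      ∫ z, gaussianLogDensity μ S z ∂(multivariateGaussian μ S) := by
    rw [multivariateGaussian_eq_withDensity hS μ,
      integral_withDensity_eq_integral_toReal_smul hm (by simp),
      ← multivariateGaussian_eq_withDensity hS μ]
    refine integral_congr_ae ?_
    filter_upwards [density_multivariateGaussian hS μ] with z hz
    rw [hz, Real.log_exp, ENNReal.toReal_ofReal (Real.exp_pos _).le, smul_eq_mul]
  have hint : Integrable (fun x => ‖x‖ ^ 2) (stdGaussian (EuclideanSpace ℝ (Fin n))) :=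
    (IsGaussian.memLp_two_id (μ := stdGaussian (EuclideanSpace ℝ (Fin n)))).integrable_norm_pow
      two_ne_zero
  -- In standard coordinates the quadratic form becomes `‖x‖ ^ 2`, so the covariance enters only
  -- through its determinant.
  rw [entropy, h1, multivariateGaussian, integral_map (by fun_prop)
    (continuous_gaussianLogDensity μ S).aestronglyMeasurable]
  simp_rw [gaussianLogDensity_affine hS]
  rw [integral_sub (integrable_const _) (hint.const_mul _), integral_const, integral_const_mul]
  simp
  ring

theorem generalizedVariance_multivariateGaussian {S : Matrix (Fin n) (Fin n) ℝ} (hS : S.PosDef)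
    (μ : EuclideanSpace ℝ (Fin n)) :
    generalizedVariance (multivariateGaussian μ S) = S.det := by
  have : covMatrix (multivariateGaussian μ S) = S := by
    ext i j
    exact covariance_eval_multivariateGaussian hS.posSemidef i j
  rw [generalizedVariance, this]

theorem entropy_eq_iff {S Ψ : Matrix (Fin n) (Fin n) ℝ} (hS : S.PosDef) (hΨ : Ψ.PosDef)
    (μ ν : EuclideanSpace ℝ (Fin n)) :
    entropy (multivariateGaussian ν Ψ) = entropy (multivariateGaussian μ S) ↔ Ψ.det = S.det := by
  rw [entropy_multivariateGaussian hS, entropy_multivariateGaussian hΨ, add_left_inj]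
  constructor
  · intro h
    exact Real.log_injOn_pos hΨ.det_pos hS.det_pos (mul_left_cancel₀ (by norm_num) h)
  · intro h; rw [h]

/-! ### Closed form of the divergence and reduction to the objective. -/

/-- Completing the square for a convex combination of two quadratic forms. -/
theorem exists_complete_square {ι : Type*} [Fintype ι] [DecidableEq ι] {P Q : Matrix ι ι ℝ}
    (hP : P.PosDef) (hQ : Q.PosDef) {α : ℝ} (hα : α ∈ Ioo (0 : ℝ) 1) (μ ν : ι → ℝ) :
    ∃ (w : ι → ℝ) (κ : ℝ), 0 ≤ κ ∧ (κ = 0 ↔ ν = μ) ∧ ∀ z : ι → ℝ,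
      α * ((z - μ) ⬝ᵥ P *ᵥ (z - μ)) + (1 - α) * ((z - ν) ⬝ᵥ Q *ᵥ (z - ν)) =
        (z - w) ⬝ᵥ (α • P + (1 - α) • Q) *ᵥ (z - w) + κ := by
  have h1 : 0 < 1 - α := sub_pos.2 hα.2
  set T := α • P + (1 - α) • Q with hT
  have hTpos : T.PosDef := (hP.smul hα.1).add (hQ.smul h1)
  have hPs : Pᵀ = P := by simpa using hP.isHermitian.eq
  have hQs : Qᵀ = Q := by simpa using hQ.isHermitian.eq
  -- The critical point of the combined form, so the cross term in `z - w` vanishes; `κ` is the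
  -- value there, a sum of two nonnegative terms that vanish together only if `w = μ` and `w = ν`.
  set w := T⁻¹ *ᵥ (α • P *ᵥ μ + (1 - α) • Q *ᵥ ν) with hw
  have hTw : T *ᵥ w = α • P *ᵥ μ + (1 - α) • Q *ᵥ ν := by
    rw [hw, mulVec_mulVec, mul_nonsing_inv _ hTpos.det_pos.ne'.isUnit, one_mulVec]
  have hcross : α • P *ᵥ (w - μ) + (1 - α) • Q *ᵥ (w - ν) = 0 := by
    have h : T *ᵥ w = α • P *ᵥ w + (1 - α) • Q *ᵥ w := by
      rw [hT, add_mulVec, smul_mulVec, smul_mulVec]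
    rw [mulVec_sub, mulVec_sub, smul_sub, smul_sub]
    rw [h] at hTw
    rw [sub_add_sub_comm, hTw, sub_self]
  have hnn : ∀ {A : Matrix ι ι ℝ}, A.PosDef → ∀ v : ι → ℝ, 0 ≤ v ⬝ᵥ A *ᵥ v := fun hA v => by
    simpa using hA.posSemidef.dotProduct_mulVec_nonneg v
  have hzero : ∀ {A : Matrix ι ι ℝ}, A.PosDef → ∀ v : ι → ℝ, v ⬝ᵥ A *ᵥ v = 0 → v = 0 :=
    fun hA v hv => by
      by_contra hne
      have := hA.dotProduct_mulVec_pos hne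
      rw [star_trivial, hv] at this
      exact lt_irrefl _ this
  have hexpand : ∀ {A : Matrix ι ι ℝ}, Aᵀ = A → ∀ x y : ι → ℝ,
      (x + y) ⬝ᵥ A *ᵥ (x + y) = x ⬝ᵥ A *ᵥ x + 2 * (x ⬝ᵥ A *ᵥ y) + y ⬝ᵥ A *ᵥ y :=
    fun {A} hA x y => by
      have : y ⬝ᵥ A *ᵥ x = x ⬝ᵥ A *ᵥ y := by
        rw [dotProduct_mulVec, ← mulVec_transpose, hA, dotProduct_comm]
      rw [mulVec_add, add_dotProduct, dotProduct_add, dotProduct_add, this]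
      ring
  have hμ0 := mul_nonneg hα.1.le (hnn hP (w - μ))
  have hν0 := mul_nonneg h1.le (hnn hQ (w - ν))
  refine ⟨w, α * ((w - μ) ⬝ᵥ P *ᵥ (w - μ)) + (1 - α) * ((w - ν) ⬝ᵥ Q *ᵥ (w - ν)),
    add_nonneg hμ0 hν0, ⟨fun h => ?_, fun h => ?_⟩, fun z => ?_⟩
  · have hμ := (mul_eq_zero.1 (show α * ((w - μ) ⬝ᵥ P *ᵥ (w - μ)) = 0 by linarith)).resolve_left
      hα.1.ne'
    have hν := (mul_eq_zero.1
      (show (1 - α) * ((w - ν) ⬝ᵥ Q *ᵥ (w - ν)) = 0 by linarith)).resolve_left h1.ne'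
    rw [← sub_eq_zero.1 (hzero hP _ hμ), ← sub_eq_zero.1 (hzero hQ _ hν)]
  · have hwμ : w - μ = 0 := by
      have h0 : T *ᵥ (w - μ) = 0 := by
        rw [hT, add_mulVec, smul_mulVec, smul_mulVec]
        rwa [h] at hcross
      refine hzero hTpos _ ?_
      rw [h0, dotProduct_zero]
    rw [h, hwμ]
    simp
  · have hz : ∀ v : ι → ℝ, z - v = (z - w) + (w - v) := fun v => by abel
    have hc : α * ((z - w) ⬝ᵥ P *ᵥ (w - μ)) + (1 - α) * ((z - w) ⬝ᵥ Q *ᵥ (w - ν)) = 0 := by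
      have := congrArg (fun v => (z - w) ⬝ᵥ v) hcross
      simpa [dotProduct_add, dotProduct_smul] using this
    rw [hz μ, hz ν, hexpand hPs, hexpand hQs, hT, add_mulVec, smul_mulVec, smul_mulVec,
      dotProduct_add, dotProduct_smul, dotProduct_smul, smul_eq_mul, smul_eq_mul]
    linear_combination 2 * hc

/-- The interpolated precision factors as `S⁻¹ * interp S α d * (diagonal d)⁻¹`; this is how
`interp` enters the divergence. -/
theorem det_precision_interp {S : Matrix (Fin n) (Fin n) ℝ} (hS : S.PosDef) {d : Fin n → ℝ}
    (hd : ∀ i, 0 < d i) (α : ℝ) :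
    (α • S⁻¹ + (1 - α) • (diagonal d)⁻¹).det =
      S.det⁻¹ * (interp S α d).det * (diagonal d).det⁻¹ := by
  have hD : (diagonal d).PosDef := PosDef.diagonal hd
  have h : α • S⁻¹ + (1 - α) • (diagonal d)⁻¹ = S⁻¹ * interp S α d * (diagonal d)⁻¹ := by
    rw [interp, Matrix.mul_add, Matrix.add_mul, Matrix.mul_smul, Matrix.mul_smul, Matrix.smul_mul,
      Matrix.smul_mul, Matrix.mul_assoc, mul_nonsing_inv _ hD.det_pos.ne'.isUnit, Matrix.mul_one,
      nonsing_inv_mul _ hS.det_pos.ne'.isUnit, Matrix.one_mul]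
  rw [h, det_mul, det_mul, det_nonsing_inv, det_nonsing_inv, Ring.inverse_eq_inv']

/-- The Rényi divergence between a Gaussian and a factorized Gaussian in closed form. The number
`κ` is the penalty for a mismatch of the means. -/
theorem exists_renyiDiv_eq {S : Matrix (Fin n) (Fin n) ℝ} (hS : S.PosDef) {d : Fin n → ℝ}
    (hd : ∀ i, 0 < d i) {α : ℝ} (hα : α ∈ Ioo (0 : ℝ) 1) (μ ν : EuclideanSpace ℝ (Fin n)) :
    ∃ κ : ℝ, 0 ≤ κ ∧ (κ = 0 ↔ ν = μ) ∧
      renyiDiv α (multivariateGaussian μ S) (multivariateGaussian ν (diagonal d)) =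
        1 / (α * (α - 1)) * (Real.exp (1 / 2 *
          ((1 - α) * Real.log S.det - objective S α d - κ)) - 1) := by
  have h1 : 0 < 1 - α := sub_pos.2 hα.2
  have hD : (diagonal d).PosDef := PosDef.diagonal hd
  obtain ⟨w, κ, hκ, hκ0, hsq⟩ := exists_complete_square hS.inv hD.inv hα μ.ofLp ν.ofLp
  refine ⟨κ, hκ, hκ0.trans ⟨fun h => WithLp.ofLp_injective 2 h, fun h => h ▸ rfl⟩, ?_⟩
  set T := α • S⁻¹ + (1 - α) • (diagonal d)⁻¹ with hT
  have hTpos : T.PosDef := (hS.inv.smul hα.1).add (hD.inv.smul h1)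
  have hM := posDef_interp hS ⟨hα.1.le, hα.2.le⟩ hd
  have hlogT : Real.log T⁻¹.det =
      Real.log S.det + Real.log (diagonal d).det - Real.log (interp S α d).det := by
    rw [det_nonsing_inv, Ring.inverse_eq_inv', Real.log_inv, hT, det_precision_interp hS hd,
      Real.log_mul (mul_pos (inv_pos.2 hS.det_pos) hM.det_pos).ne' (inv_pos.2 hD.det_pos).ne',
      Real.log_mul (inv_pos.2 hS.det_pos).ne' hM.det_pos.ne', Real.log_inv, Real.log_inv]
    ring
  have hlogD : Real.log (diagonal d).det = ∑ i, Real.log (d i) := by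
    rw [det_diagonal, Real.log_prod fun i _ => (hd i).ne']
  -- Thus `p ^ α * q ^ (1 - α)` is a constant times the Gaussian density of mean `w` and covariance
  -- `T⁻¹`, and its integral is that constant.
  have hcomb : ∀ z, α * gaussianLogDensity μ S z + (1 - α) * gaussianLogDensity ν (diagonal d) z =
      1 / 2 * ((1 - α) * Real.log S.det - objective S α d - κ) +
        gaussianLogDensity (WithLp.toLp 2 w) T⁻¹ z := by
    intro z
    have h := hsq z.ofLp
    simp only [gaussianLogDensity, nonsing_inv_nonsing_inv _ hTpos.det_pos.ne'.isUnit, hlogT,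
      objective, WithLp.ofLp_sub, ← hlogD]
    linear_combination (-1 / 2) * h
  have hae : (fun z => (density (multivariateGaussian μ S) z ^ α /
        density (multivariateGaussian ν (diagonal d)) z ^ α - 1) *
        density (multivariateGaussian ν (diagonal d)) z) =ᵐ[volume] fun z =>
      Real.exp (1 / 2 * ((1 - α) * Real.log S.det - objective S α d - κ)) *
        Real.exp (gaussianLogDensity (WithLp.toLp 2 w) T⁻¹ z) -
        Real.exp (gaussianLogDensity ν (diagonal d) z) := by
    filter_upwards [density_multivariateGaussian hS μ, density_multivariateGaussian hD ν]
      with z hz1 hz2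
    rw [hz1, hz2, ← Real.exp_mul, ← Real.exp_mul, ← Real.exp_sub, sub_mul, one_mul,
      ← Real.exp_add, ← Real.exp_add, ← hcomb z]
    congr 2
    ring
  rw [renyiDiv, integral_congr_ae hae, integral_sub
    ((integrable_exp_gaussianLogDensity hTpos.inv _).const_mul _)
    (integrable_exp_gaussianLogDensity hD ν), integral_const_mul,
    integral_exp_gaussianLogDensity hTpos.inv, integral_exp_gaussianLogDensity hD, mul_one]

theorem mem_factorizedGaussians_iff (q : Measure (EuclideanSpace ℝ (Fin n))) :
    q ∈ factorizedGaussians n ↔ ∃ (ν : EuclideanSpace ℝ (Fin n)) (d : Fin n → ℝ),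
      (∀ i, 0 < d i) ∧ q = multivariateGaussian ν (diagonal d) := by
  constructor
  · rintro ⟨ν, Ψ, hΨ, hdiag, rfl⟩
    exact ⟨ν, diag Ψ, fun i => hΨ.diag_pos, by rw [hdiag.diagonal_diag]⟩
  · rintro ⟨ν, d, hd, rfl⟩
    exact ⟨ν, diagonal d, PosDef.diagonal hd, isDiag_diagonal d, rfl⟩

/-- Among factorized Gaussians, the minimizer of the Rényi divergence has the mean of the target,
and its variances minimize the objective. -/
theorem isRenyiMinimizer_iff {S : Matrix (Fin n) (Fin n) ℝ} (hS : S.PosDef) {α : ℝ}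
    (hα : α ∈ Ioo (0 : ℝ) 1) (μ : EuclideanSpace ℝ (Fin n)) {d : Fin n → ℝ}
    (hd : ∀ i, 0 < d i)
    (hmin : ∀ e : Fin n → ℝ, (∀ i, 0 < e i) → e ≠ d → objective S α d < objective S α e)
    (q : Measure (EuclideanSpace ℝ (Fin n))) :
    IsRenyiMinimizer α (multivariateGaussian μ S) q ↔ q = multivariateGaussian μ (diagonal d) := by
  -- The negative prefactor turns minimizing the divergence into minimizing `objective` plus `κ`,
  -- and the two terms are minimized separately.
  have hc : 1 / (α * (α - 1)) < 0 :=
    one_div_neg.2 (mul_neg_of_pos_of_neg hα.1 (sub_neg.2 hα.2))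
  have hle : ∀ e : Fin n → ℝ, (∀ i, 0 < e i) → objective S α d ≤ objective S α e := fun e he => by
    by_cases h : e = d
    · rw [h]
    · exact (hmin e he h).le
  have hmem : multivariateGaussian μ (diagonal d) ∈ factorizedGaussians n :=
    (mem_factorizedGaussians_iff _).2 ⟨μ, d, hd, rfl⟩
  obtain ⟨κ, -, hκ, hval⟩ := exists_renyiDiv_eq hS hd hα μ μ
  rw [hκ.2 rfl] at hval
  constructor
  · rintro ⟨hq, hqmin⟩
    obtain ⟨ν, e, he, rfl⟩ := (mem_factorizedGaussians_iff q).1 hq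
    obtain ⟨κ', hκ', hκ0, hval'⟩ := exists_renyiDiv_eq hS he hα μ ν
    have h := isMinOn_iff.1 hqmin _ hmem
    rw [hval, hval', mul_le_mul_left_of_neg hc, sub_le_sub_iff_right, Real.exp_le_exp] at h
    have hobj := hle e he
    have hνμ : ν = μ := hκ0.1 (by linarith)
    have hed : e = d := by
      by_contra hne
      have := hmin e he hne
      linarith
    rw [hνμ, hed]
  · rintro rfl
    refine ⟨hmem, isMinOn_iff.2 fun q' hq' => ?_⟩
    obtain ⟨ν, e, he, rfl⟩ := (mem_factorizedGaussians_iff q').1 hq'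
    obtain ⟨κ', hκ', -, hval'⟩ := exists_renyiDiv_eq hS he hα μ ν
    rw [hval, hval', mul_le_mul_left_of_neg hc, sub_le_sub_iff_right, Real.exp_le_exp]
    have hobj := hle e he
    linarith

end Gaussian

end FactorizedVI

/-! ### Assembly of the three claims. -/

theorem mainTheorem6 (n : ℕ) (μ : EuclideanSpace ℝ (Fin n)) (S : Matrix (Fin n) (Fin n) ℝ)
    (hS : S.PosDef) (hdiag : ¬ S.IsDiag) :
    -- for each order the minimizing factorized Gaussian exists and is unique
    (∀ α ∈ Ioo (0 : ℝ) 1,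
      ∃! q, FactorizedVI.IsRenyiMinimizer α (multivariateGaussian μ S) q) ∧
    -- exactly one order matches the entropy
    (∃! α : ℝ, α ∈ Ioo (0 : ℝ) 1 ∧
      ∃ q, FactorizedVI.IsRenyiMinimizer α (multivariateGaussian μ S) q ∧
        FactorizedVI.entropy q = FactorizedVI.entropy (multivariateGaussian μ S)) ∧
    -- matching the entropy is the same as matching the generalized variance
    (∀ q ∈ FactorizedVI.factorizedGaussians n,
      FactorizedVI.entropy q = FactorizedVI.entropy (multivariateGaussian μ S) ↔
        FactorizedVI.generalizedVariance q =
          FactorizedVI.generalizedVariance (multivariateGaussian μ S)) := by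
  have hmatch : ∀ {α : ℝ}, α ∈ Ioo (0 : ℝ) 1 →
      (∃ q, FactorizedVI.IsRenyiMinimizer α (multivariateGaussian μ S) q ∧
        FactorizedVI.entropy q = FactorizedVI.entropy (multivariateGaussian μ S)) →
      ∃ d : Fin n → ℝ, (∀ i, 0 < d i) ∧
        (∀ i, d i * (FactorizedVI.interp S α d)⁻¹ i i = 1) ∧ ∏ i, d i = S.det := by
    rintro α hα ⟨q, hq, hent⟩
    obtain ⟨d, hd, hsol, hmin⟩ := FactorizedVI.exists_minimizer hS hα
    rw [(FactorizedVI.isRenyiMinimizer_iff hS hα μ hd hmin q).1 hq,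
      FactorizedVI.entropy_eq_iff hS (Matrix.PosDef.diagonal hd), Matrix.det_diagonal] at hent
    exact ⟨d, hd, hsol, hent⟩
  -- The product of variances is strictly increasing in the order, which leaves at most one order
  -- with product `det S`.
  have hlt : ∀ {α β : ℝ}, α ∈ Ioo (0 : ℝ) 1 → β ∈ Ioo (0 : ℝ) 1 → α < β →
      ∀ {a b : Fin n → ℝ}, (∀ i, 0 < a i) → (∀ i, 0 < b i) →
      (∀ i, a i * (FactorizedVI.interp S α a)⁻¹ i i = 1) →
      (∀ i, b i * (FactorizedVI.interp S β b)⁻¹ i i = 1) → ∏ i, a i < ∏ i, b i := by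
    intro α β hα hβ hαβ a b ha hb hsa hsb
    obtain ⟨hle, k, hk⟩ := Pi.lt_def.1
      (FactorizedVI.solution_strictMono hS hdiag hα.1.le hαβ hβ.2 ha hb hsa hsb)
    exact Finset.prod_lt_prod (fun i _ => ha i) (fun i _ => hle i) ⟨k, Finset.mem_univ k, hk⟩
  refine ⟨fun α hα => ?_, ?_, fun q hq => ?_⟩
  · obtain ⟨d, hd, -, hmin⟩ := FactorizedVI.exists_minimizer hS hα
    exact ⟨multivariateGaussian μ (Matrix.diagonal d),
      (FactorizedVI.isRenyiMinimizer_iff hS hα μ hd hmin _).2 rfl,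
      fun q hq => (FactorizedVI.isRenyiMinimizer_iff hS hα μ hd hmin q).1 hq⟩
  · obtain ⟨α, hα, d, hd, hsol, hdet⟩ := FactorizedVI.exists_order_prod_eq_det hS hdiag
    refine ⟨α, ⟨hα, multivariateGaussian μ (Matrix.diagonal d), ?_, ?_⟩, ?_⟩
    · obtain ⟨e, he, hsol', hmin⟩ := FactorizedVI.exists_minimizer hS hα
      rw [FactorizedVI.isRenyiMinimizer_iff hS hα μ he hmin,
        FactorizedVI.solution_unique hS ⟨hα.1.le, hα.2⟩ hd he hsol hsol']
    · rw [FactorizedVI.entropy_eq_iff hS (Matrix.PosDef.diagonal hd), Matrix.det_diagonal, hdet]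
    · rintro β ⟨hβ, hq⟩
      obtain ⟨e, he, hsol', hdet'⟩ := hmatch hβ hq
      rcases lt_trichotomy β α with h | h | h
      · have := hlt hβ hα h he hd hsol' hsol
        rw [hdet, hdet'] at this
        exact absurd this (lt_irrefl _)
      · exact h
      · have := hlt hα hβ h hd he hsol hsol'
        rw [hdet, hdet'] at this
        exact absurd this (lt_irrefl _)
  · obtain ⟨ν, Ψ, hΨ, -, rfl⟩ := hq
    rw [FactorizedVI.entropy_eq_iff hS hΨ,
      FactorizedVI.generalizedVariance_multivariateGaussian hS,
      FactorizedVI.generalizedVariance_multivariateGaussian hΨ]
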